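/- Let $n\ge 1$. A Gelfand–Tsetlin triangle of size $n$ is an array $X=(X_{i,j})_{n\ge i\ge j\ge 1}$ of positive integers with $X_{i+1,j}\le X_{i,j}\le X_{i+1,j+1}$ for $n-1\ge i\ge j\ge 1$; triangles are ordered entrywise. For $1\le k\le n-1$ let $s_k$ be the map on Gelfand–Tsetlin triangles which changes only row $k$, replacing $X_{k,j}$ by $$\max(X_{k+1,j},X_{k-1,j-1})+\min(X_{k+1,j+1},X_{k-1,j})-X_{k,j},$$ where an entry $X_{k-1,j-1}$ or $X_{k-1,j}$ that does not exist is omitted from the maximum or minimum. Put $\omega_j=s_js_{j-1}\cdots s_1$; the Schützenberger involution is $S=\omega_1\omega_2\cdots\omega_{n-1}$ (compositions of maps). A Magog triangle is a Gelfand–Tsetlin triangle with $X_{j,j}\le j$ for $1\le j\le n$, and a GOGAm triangle is a Gelfand–Tsetlin triangle $X$ such that $S(X)$ is a Magog triangle. For $1\le k\le n$, an $(n,k)$ right (respectively left) GOGAm trapezoid is an array indexed by the pairs $n\ge i\ge j\ge1$ with $i-j\le k-1$ (respectively with $j\le k$) which is the restriction to these positions of some GOGAm triangle of size $n$. **Proposition.**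 Let $1\le k\le n$. 1. For every $(n,k)$ right GOGAm trapezoid $X$ there is a smallest GOGAm triangle of size $n$ that extends $X$ (its canonical completion). Its added entries are $X_{i,j}=1$ for $n\ge i\ge j+k$, $j\ge 1$. 2. For every $(n,k)$ left GOGAm trapezoid $X$ there is a smallest GOGAm triangle of size $n$ that extends $X$ (its canonical completion). It satisfies $X_{i,j}=X_{i-j+k,k}$ for $n\ge i\ge j\ge k$; that is, the added entries are constant on SW–NE diagonals. -/

import Mathlib

/-- The positions `(i, j)` with `n ≥ i ≥ j ≥ 1` of a triangular array of size `n`;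
`i` is the row (row `n` is the top one) and `j` the place in the row. -/
def triangleIndex (n : ℕ) : Finset (ℕ × ℕ) :=
  (Finset.Icc 1 n ×ˢ Finset.Icc 1 n).filter fun p => p.2 ≤ p.1

/-- The positions on the `k` rightmost SW-NE diagonals, `i - j ≤ k - 1`. -/
def rightIndex (n k : ℕ) : Finset (ℕ × ℕ) :=
  (triangleIndex n).filter fun p => p.1 < p.2 + k

/-- The positions on the `k` leftmost NW-SE diagonals, `j ≤ k`. -/
def leftIndex (n k : ℕ) : Finset (ℕ × ℕ) :=
  (triangleIndex n).filter fun p => p.2 ≤ k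

theorem rightIndex_subset (n k : ℕ) : rightIndex n k ⊆ triangleIndex n :=
  Finset.filter_subset _ _

theorem leftIndex_subset (n k : ℕ) : leftIndex n k ⊆ triangleIndex n :=
  Finset.filter_subset _ _

/-- Arrays of integers with set of positions `s`. The order `≤` on them is the entrywise one. -/
abbrev IntArray (s : Finset (ℕ × ℕ)) : Type := s → ℤ

/-- The entry `X_{i,j}`, with the value `0` when `(i, j)` is not a position of the array. -/
def IntArray.entry {s : Finset (ℕ × ℕ)} (X : IntArray s) (i j : ℕ) : ℤ :=
  if h : (i, j) ∈ s then X ⟨(i, j), h⟩ else 0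

/-- Gelfand-Tsetlin triangles of size `n` (with positive entries). -/
structure IsGelfandTsetlin {n : ℕ} (X : IntArray (triangleIndex n)) : Prop where
  pos : ∀ p, 0 < X p
  interlace : ∀ i j : ℕ, 1 ≤ j → j ≤ i → i + 1 ≤ n →
    X.entry (i + 1) j ≤ X.entry i j ∧ X.entry i j ≤ X.entry (i + 1) (j + 1)

/-- The map `s_k`, used for `1 ≤ k ≤ n - 1`: the entries of row `k` are replaced by
`max (X_{k+1,j}, X_{k-1,j-1}) + min (X_{k+1,j+1}, X_{k-1,j}) - X_{k,j}`, where the entry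
`X_{k-1,j-1}` is left out of the maximum for `j = 1`, and the entry `X_{k-1,j}` is left out
of the minimum for `j = k`, since they do not exist. -/
def rowReflection {n : ℕ} (k : ℕ) (X : IntArray (triangleIndex n)) :
    IntArray (triangleIndex n) := fun p =>
  let j := p.1.2
  if p.1.1 = k then
    (if j = 1 then X.entry (k + 1) j else max (X.entry (k + 1) j) (X.entry (k - 1) (j - 1)))
      + (if j = k then X.entry (k + 1) (j + 1)
          else min (X.entry (k + 1) (j + 1)) (X.entry (k - 1) j))
      - X p
  else X p

/-- `ω_j = s_j s_{j-1} ⋯ s_1`, so that `s_1` acts first. -/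
def rowSweep {n : ℕ} : ℕ → IntArray (triangleIndex n) → IntArray (triangleIndex n)
  | 0 => id
  | j + 1 => rowReflection (j + 1) ∘ rowSweep j

/-- `ω_1 ω_2 ⋯ ω_m`, so that `ω_m` acts first. -/
def sweepProduct {n : ℕ} : ℕ → IntArray (triangleIndex n) → IntArray (triangleIndex n)
  | 0 => id
  | m + 1 => sweepProduct m ∘ rowSweep (m + 1)

/-- The Schützenberger involution `S = ω_1 ω_2 ⋯ ω_{n-1}` on triangles of size `n`. -/
def schutzenberger {n : ℕ} (X : IntArray (triangleIndex n)) : IntArray (triangleIndex n) :=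
  sweepProduct (n - 1) X

/-- Magog triangles: Gelfand-Tsetlin triangles with `X_{j,j} ≤ j`. -/
structure IsMagog {n : ℕ} (X : IntArray (triangleIndex n)) : Prop where
  gelfandTsetlin : IsGelfandTsetlin X
  diagonal : ∀ j : ℕ, 1 ≤ j → j ≤ n → X.entry j j ≤ j

/-- GOGAm triangles: Gelfand-Tsetlin triangles whose image under the Schützenberger
involution is a Magog triangle. -/
structure IsGOGAm {n : ℕ} (X : IntArray (triangleIndex n)) : Prop where
  gelfandTsetlin : IsGelfandTsetlin X
  magog : IsMagog (schutzenberger X)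

/-- The triangle `T` extends the right trapezoidal array `X`. -/
def ExtendsRight {n k : ℕ} (T : IntArray (triangleIndex n)) (X : IntArray (rightIndex n k)) :
    Prop :=
  ∀ p (hp : p ∈ rightIndex n k), T ⟨p, rightIndex_subset n k hp⟩ = X ⟨p, hp⟩

/-- The triangle `T` extends the left trapezoidal array `X`. -/
def ExtendsLeft {n k : ℕ} (T : IntArray (triangleIndex n)) (X : IntArray (leftIndex n k)) :
    Prop :=
  ∀ p (hp : p ∈ leftIndex n k), T ⟨p, leftIndex_subset n k hp⟩ = X ⟨p, hp⟩

/-- `(n, k)` right GOGAm trapezoids. -/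
def IsRightGOGAmTrapezoid {n k : ℕ} (X : IntArray (rightIndex n k)) : Prop :=
  ∃ T : IntArray (triangleIndex n), IsGOGAm T ∧ ExtendsRight T X

/-- `(n, k)` left GOGAm trapezoids. -/
def IsLeftGOGAmTrapezoid {n k : ℕ} (X : IntArray (leftIndex n k)) : Prop :=
  ∃ T : IntArray (triangleIndex n), IsGOGAm T ∧ ExtendsLeft T X

/-- `C` is the canonical completion of the right trapezoid `X`: the smallest GOGAm triangle
that extends it. -/
def IsRightCompletion {n k : ℕ} (X : IntArray (rightIndex n k))
    (C : IntArray (triangleIndex n)) : Prop :=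
  IsLeast {T : IntArray (triangleIndex n) | IsGOGAm T ∧ ExtendsRight T X} C

/-- `C` is the canonical completion of the left trapezoid `X`: the smallest GOGAm triangle
that extends it. -/
def IsLeftCompletion {n k : ℕ} (X : IntArray (leftIndex n k))
    (C : IntArray (triangleIndex n)) : Prop :=
  IsLeast {T : IntArray (triangleIndex n) | IsGOGAm T ∧ ExtendsLeft T X} C

/-! Subtracting `1` from all entries turns a Gelfand-Tsetlin triangle into a sequence of
interlacing partitions, that is, a semistandard tableau with letters `1, …, n`, and the sweep `ω_m`
into the promotion step of jeu de taquin: delete the letters `1` and rectify. The longest weakly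
increasing subword of the reading word that only uses letters in `(d, d + j]` is a last passage
time in the array of letter counts, and jeu de taquin does not change it: on two consecutive rows
it replaces the demand on a store by the demand met, and its supply by the supply together with the
unmet demand, which keeps the last passage times. Following this through `S = ω_1 ⋯ ω_{n-1}` shows
that `S(X)_{j,j} - 1` is the last passage time of the letters in `(n - j, n]`. It is monotone in
the letter counts, so deleting letters from the tableau of a GOGAm triangle gives a GOGAm triangle
again. The right completion keeps the first `k` rows of the tableau, and the left completion keeps
the letters at most `r + k` in row `r` (rows being counted from `0`). -/

section LastPassage

variable {α : Type*} [AddCommGroup α] [LinearOrder α]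

/-- One line of a last passage recursion: a path enters at a place `b ≥ 1` from the line below,
whose passage times are `φ`, moves right, and collects the weights `w`. The weight of step
`b` to `b + 1` has index `b`. -/
def passageLine (φ w : ℕ → α) : ℕ → α
  | 0 => 0
  | b + 1 => max (passageLine φ w b) (φ (b + 1)) + w b

/-- Last passage times through the `s` lines with weights `w (r + s - 1), …, w (r + 1), w r`,
in this order from the bottom to the top. -/
def lastPassage (w : ℕ → ℕ → α) : ℕ → ℕ → ℕ → α
  | 0, _ => 0
  | s + 1, r => passageLine (lastPassage w s (r + 1)) (w r)

variable [IsOrderedAddMonoid α]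

theorem passageLine_mono {φ φ' w w' : ℕ → α} {B : ℕ} (hφ : ∀ b ≤ B, φ b ≤ φ' b)
    (hw : ∀ b < B, w b ≤ w' b) : ∀ b ≤ B, passageLine φ w b ≤ passageLine φ' w' b
  | 0, _ => le_rfl
  | b + 1, hb => add_le_add
      (max_le_max (passageLine_mono hφ hw b (Nat.le_of_succ_le hb)) (hφ _ hb)) (hw b hb)

theorem lastPassage_mono {w w' : ℕ → ℕ → α} {B : ℕ} (h : ∀ r, ∀ b < B, w r b ≤ w' r b) :
    ∀ s r, ∀ b ≤ B, lastPassage w s r b ≤ lastPassage w' s r b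
  | 0, _ => fun _ _ => le_rfl
  | s + 1, r => passageLine_mono (lastPassage_mono h s (r + 1)) (h r)

theorem lastPassage_congr {w w' : ℕ → ℕ → α} {B : ℕ} (h : ∀ r, ∀ b < B, w r b = w' r b)
    (s r : ℕ) : lastPassage w s r B = lastPassage w' s r B :=
  le_antisymm (lastPassage_mono (fun r b hb => (h r b hb).le) s r B le_rfl)
    (lastPassage_mono (fun r b hb => (h r b hb).ge) s r B le_rfl)

section Store

/-! At time `b` a store with stock `g b` meets the part `p b ⊓ g b` of the demand `p b`, keeps the
rest of the stock, and receives the supply `q b`. -/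

variable {φ p q g : ℕ → α}

theorem passageLine_eq_max_passageLine_inf (h0 : 0 ≤ g 0)
    (hg : ∀ b, g (b + 1) = q b + max (g b - p b) 0) :
    ∀ b, passageLine φ p b =
      max (passageLine φ (p ⊓ g) b) (passageLine (passageLine φ p) q b - g b)
  | 0 => by simpa [passageLine] using h0
  | b + 1 => by
    have ih := passageLine_eq_max_passageLine_inf h0 hg b
    simp only [passageLine, hg, Pi.inf_apply]
    grind

theorem passageLine_passageLine_inf (h0 : 0 ≤ g 0)
    (hg : ∀ b, g (b + 1) = q b + max (g b - p b) 0) :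
    passageLine (passageLine φ (p ⊓ g)) (q + p - p ⊓ g) = passageLine (passageLine φ p) q := by
  ext b
  induction b with
  | zero => rfl
  | succ b ih =>
    have first_line := passageLine_eq_max_passageLine_inf (φ := φ) h0 hg b
    simp only [passageLine, Pi.inf_apply, Pi.add_apply, Pi.sub_apply, ih]
    grind

end Store

end LastPassage

section Pattern

variable {α : Type*}

/-- `μ` interlaces with `ν` from below: `ν 0 ≥ μ 0 ≥ ν 1 ≥ μ 1 ≥ …`. For partitions this says
that `ν / μ` is a horizontal strip. -/
def Interlaces [LE α] (ν μ : ℕ → α) : Prop :=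
  ∀ r, ν (r + 1) ≤ μ r ∧ μ r ≤ ν r

/-- Interlacing sequences of partitions starting from the empty one, equivalently semistandard
tableaux: the `i`-th partition `L i`, with parts `L i 0 ≥ L i 1 ≥ …`, is the shape of the letters
`1, …, i`. -/
structure IsPattern [Zero α] [LE α] (L : ℕ → ℕ → α) : Prop where
  zero : ∀ r, L 0 r = 0
  interlaces : ∀ i, Interlaces (L (i + 1)) (L i)

namespace IsPattern

variable [Zero α] [Preorder α] {L : ℕ → ℕ → α}

theorem monotone (hL : IsPattern L) (r : ℕ) : Monotone fun i => L i r :=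
  monotone_nat_of_le_succ fun i => (hL.interlaces i r).2

theorem nonneg (hL : IsPattern L) (i r : ℕ) : 0 ≤ L i r :=
  (hL.zero r).ge.trans (hL.monotone r i.zero_le)

theorem truncate (hL : IsPattern L) (k : ℕ) :
    IsPattern fun i r => if r < k then L i r else 0 where
  zero r := by simp only [hL.zero, ite_self]
  interlaces i r := by
    have interlace := hL.interlaces i r
    have part_nonneg := hL.nonneg i r
    dsimp only
    grind

theorem stabilize (hL : IsPattern L) (k : ℕ) : IsPattern fun i r => L (min i (r + k)) r where
  zero r := by rw [Nat.zero_min, hL.zero]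
  interlaces i r := by
    refine ⟨?_, hL.monotone r (min_le_min_right _ i.le_succ)⟩
    dsimp only
    rw [Nat.add_right_comm r 1 k, Nat.add_min_add_right]
    exact (hL.interlaces _ r).1

end IsPattern

theorem IsPattern.eq_zero [Zero α] [PartialOrder α] {L : ℕ → ℕ → α} (hL : IsPattern L) :
    ∀ i r, i ≤ r → L i r = 0
  | 0, r, _ => hL.zero r
  | i + 1, r + 1, h => le_antisymm
    ((hL.interlaces i r).1.trans_eq (hL.eq_zero i r (Nat.le_of_succ_le_succ h))) (hL.nonneg _ _)

variable [AddCommGroup α] [LinearOrder α]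

/-- The row `ρ` of a pattern between the rows `ν` and `μ`, reflected part by part in the middle of
the interval which `ν` and `μ` leave to it. -/
def reflectedRow (ν ρ μ : ℕ → α) : ℕ → α
  | 0 => max (ν 1) (μ 0) + ν 0 - ρ 0
  | r + 1 => max (ν (r + 2)) (μ (r + 1)) + min (ν (r + 1)) (μ r) - ρ (r + 1)

/-- Schützenberger promotion of a tableau: delete the letters `1`, rectify, and lower the
remaining letters by `1`. -/
def promotion (L : ℕ → ℕ → α) : ℕ → ℕ → α
  | 0 => 0
  | i + 1 => reflectedRow (L (i + 2)) (L (i + 1)) (promotion L i)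

/-- The number of letters `d + b + 1` in the `r`-th row of the tableau `L`. -/
def letterCount (L : ℕ → ℕ → α) (d r b : ℕ) : α :=
  L (b + d + 1) r - L (b + d) r

/-- The number of letters `i + 2` that move from row `r` to row `r - 1` in the promotion of `L`. -/
def liftedCount (L : ℕ → ℕ → α) (i : ℕ) : ℕ → α
  | 0 => 0
  | r + 1 => max (L (i + 2) (r + 1) - promotion L i r) 0

theorem IsPattern.lastPassage_letterCount_zero {L : ℕ → ℕ → α} (hL : IsPattern L) {N : ℕ}
    (hN : ∀ i r, N ≤ r → L i r = 0) :
    ∀ s r, N ≤ r + s → ∀ b, lastPassage (letterCount L 0) s r b = L b r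
  | 0, r, hr, b => (hN b r hr).symm
  | _ + 1, r, _, 0 => (hL.zero r).symm
  | s + 1, r, hr, b + 1 => by
    have row := hL.lastPassage_letterCount_zero hN (s + 1) r hr b
    have below := hL.lastPassage_letterCount_zero hN s (r + 1) (by omega) (b + 1)
    rw [lastPassage] at row ⊢
    rw [passageLine, row, below, letterCount, add_zero, max_eq_left (hL.interlaces b r).1,
      add_sub_cancel]

variable [IsOrderedAddMonoid α]

namespace Interlaces

variable {ν ρ μ : ℕ → α}

theorem le_reflectedRow (hν : Interlaces ν ρ) (hμ : Interlaces ρ μ) :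
    ∀ r, max (ν (r + 1)) (μ r) ≤ reflectedRow ν ρ μ r
  | 0 => by
    rw [reflectedRow, add_sub_assoc]
    exact le_add_of_nonneg_right (sub_nonneg.2 (hν 0).2)
  | r + 1 => by
    rw [reflectedRow, add_sub_assoc]
    exact le_add_of_nonneg_right (sub_nonneg.2 (le_min (hν (r + 1)).2 (hμ r).1))

theorem reflectedRow_zero_le (hν : Interlaces ν ρ) (hμ : Interlaces ρ μ) :
    reflectedRow ν ρ μ 0 ≤ ν 0 := by
  rw [reflectedRow, add_sub_right_comm]
  exact add_le_of_nonpos_left (sub_nonpos.2 (max_le (hν 0).1 (hμ 0).2))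

theorem reflectedRow_succ_le (hν : Interlaces ν ρ) (hμ : Interlaces ρ μ) (r : ℕ) :
    reflectedRow ν ρ μ (r + 1) ≤ min (ν (r + 1)) (μ r) := by
  rw [reflectedRow, add_sub_right_comm]
  exact add_le_of_nonpos_left (sub_nonpos.2 (max_le (hν (r + 1)).1 (hμ (r + 1)).2))

theorem reflectedRow_right (hν : Interlaces ν ρ) (hμ : Interlaces ρ μ) :
    Interlaces ν (reflectedRow ν ρ μ) := fun r =>
  ⟨(le_max_left _ _).trans (hν.le_reflectedRow hμ r), match r with
    | 0 => hν.reflectedRow_zero_le hμ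
    | r + 1 => (hν.reflectedRow_succ_le hμ r).trans (min_le_left _ _)⟩

theorem reflectedRow_left (hν : Interlaces ν ρ) (hμ : Interlaces ρ μ) :
    Interlaces (reflectedRow ν ρ μ) μ := fun r =>
  ⟨(hν.reflectedRow_succ_le hμ r).trans (min_le_right _ _),
    (le_max_right _ _).trans (hν.le_reflectedRow hμ r)⟩

end Interlaces

theorem promotion_succ_sub (L : ℕ → ℕ → α) (i : ℕ) : ∀ r,
    promotion L (i + 1) r - promotion L i r =
      L (i + 2) r - L (i + 1) r - liftedCount L i r + liftedCount L i (r + 1)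
  | 0 => by
    simp only [promotion, reflectedRow, liftedCount]
    grind
  | r + 1 => by
    simp only [promotion, reflectedRow, liftedCount]
    grind

namespace IsPattern

variable {L : ℕ → ℕ → α}

theorem update_reflectedRow (hL : IsPattern L) (k : ℕ) :
    IsPattern (Function.update L (k + 1) (reflectedRow (L (k + 2)) (L (k + 1)) (L k))) where
  zero r := by rw [Function.update_of_ne k.succ_ne_zero.symm, hL.zero]
  interlaces i := by
    have above := hL.interlaces (k + 1)
    have below := hL.interlaces k
    rcases eq_or_ne i k with rfl | hik
    · rw [Function.update_self, Function.update_of_ne i.succ_ne_self.symm]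
      exact above.reflectedRow_left below
    rw [Function.update_of_ne (a := i + 1) (by omega)]
    rcases eq_or_ne i (k + 1) with rfl | hik'
    · rw [Function.update_self]
      exact above.reflectedRow_right below
    · rw [Function.update_of_ne hik']
      exact hL.interlaces i

theorem interlaces_promotion (hL : IsPattern L) : ∀ i, Interlaces (L (i + 1)) (promotion L i)
  | 0 => fun r => ⟨(hL.interlaces 0 r).1.trans (hL.zero r).le, hL.nonneg 1 r⟩
  | i + 1 => (hL.interlaces (i + 1)).reflectedRow_right (hL.interlaces_promotion i)

variable {N : ℕ}

theorem lastPassage_promotion_succ (hL : IsPattern L) (hN : ∀ i r, N ≤ r → L i r = 0) (d : ℕ) :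
    ∀ s r, N ≤ r + s + 1 → lastPassage (letterCount (promotion L) d) (s + 1) r =
      passageLine (lastPassage (letterCount L (d + 1)) s (r + 1))
        (letterCount L (d + 1) r - fun b => liftedCount L (b + d) r)
  | 0, r, hr => by
    refine congrArg (passageLine 0) (funext fun b => ?_)
    have no_lift : liftedCount L (b + d) (r + 1) = 0 := by
      have := (hL.interlaces_promotion (b + d) r).1
      rw [hN _ _ hr] at this
      rw [liftedCount, hN _ _ hr]
      grind
    rw [letterCount, promotion_succ_sub, no_lift, add_zero]
    rfl
  | s + 1, r, hr => by
    rw [lastPassage, hL.lastPassage_promotion_succ hN d s (r + 1) (by omega)]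
    set p := letterCount L (d + 1) (r + 1) with hp
    set q := letterCount L (d + 1) r - fun b => liftedCount L (b + d) r with hq
    let g b := promotion L (b + d) r - L (b + d + 1) (r + 1)
    -- Row `r + 1` has room for `g b` of its `p b` letters below row `r`; the others are lifted.
    have demand_met : p - (fun b => liftedCount L (b + d) (r + 1)) = p ⊓ g := by
      ext b
      simp only [hp, g, Pi.sub_apply, Pi.inf_apply, letterCount, liftedCount]
      grind
    have new_supply : letterCount (promotion L) d r = q + p - p ⊓ g := by
      ext b
      rw [letterCount, promotion_succ_sub, ← demand_met, hq]
      simp only [Pi.sub_apply, Pi.add_apply, letterCount]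
      grind
    rw [demand_met, new_supply]
    refine passageLine_passageLine_inf (sub_nonneg.2 (hL.interlaces_promotion _ r).1) fun b => ?_
    have := promotion_succ_sub L (b + d) r
    simp only [hp, hq, g, Pi.sub_apply, letterCount, liftedCount] at *
    grind

theorem lastPassage_promotion (hL : IsPattern L) (hN : ∀ i r, N ≤ r → L i r = 0) (d : ℕ) :
    lastPassage (letterCount (promotion L) d) N 0 = lastPassage (letterCount L (d + 1)) N 0 := by
  cases N with
  | zero => rfl
  | succ s =>
    rw [hL.lastPassage_promotion_succ hN d s 0 (by omega)]
    exact congrArg _ (sub_zero _)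

end IsPattern

end Pattern

section Triangle

variable {n : ℕ}

theorem mem_triangleIndex {i j : ℕ} : (i, j) ∈ triangleIndex n ↔ 1 ≤ j ∧ j ≤ i ∧ i ≤ n := by
  simp only [triangleIndex, Finset.mem_filter, Finset.mem_product, Finset.mem_Icc]
  omega

theorem IntArray.entry_of_mem {s : Finset (ℕ × ℕ)} (X : IntArray s) {i j : ℕ}
    (h : (i, j) ∈ s) : X.entry i j = X ⟨(i, j), h⟩ :=
  dif_pos h

/-- The `i`-th row of the triangle `X` as a partition: its `r`-th part, counted from `0`, is
`X_{i,i-r} - 1`. In order to have interlacing for all `i`, rows `i > n` are copies of row `n`. -/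
def rowPartition (X : IntArray (triangleIndex n)) (i r : ℕ) : ℤ :=
  if r < min i n then X.entry (min i n) (min i n - r) - 1 else 0

/-- The triangle of size `n` whose rows are the first `n` partitions of `L`. -/
def ofPartitions (n : ℕ) (L : ℕ → ℕ → ℤ) : IntArray (triangleIndex n) :=
  fun p => L p.1.1 (p.1.1 - p.1.2) + 1

theorem rowPartition_eq_zero (X : IntArray (triangleIndex n)) {i r : ℕ} (h : min i n ≤ r) :
    rowPartition X i r = 0 :=
  if_neg h.not_gt

theorem rowPartition_min (X : IntArray (triangleIndex n)) (i r : ℕ) :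
    rowPartition X (min i n) r = rowPartition X i r := by
  simp only [rowPartition, min_assoc, min_self]

theorem rowPartition_eq_entry_sub_one (X : IntArray (triangleIndex n)) {i r j : ℕ}
    (h : i = r + j) (hj : 1 ≤ j) (hi : i ≤ n) : rowPartition X i r = X.entry i j - 1 := by
  rw [rowPartition, min_eq_left hi, if_pos (by omega), h, Nat.add_sub_cancel_left]

theorem entry_eq_rowPartition_add_one (X : IntArray (triangleIndex n)) {i j : ℕ} (hj : 1 ≤ j)
    (hji : j ≤ i) (hi : i ≤ n) : X.entry i j = rowPartition X i (i - j) + 1 := by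
  rw [rowPartition_eq_entry_sub_one X (Nat.sub_add_cancel hji).symm hj hi, sub_add_cancel]

theorem entry_ofPartitions (L : ℕ → ℕ → ℤ) {i j : ℕ} (hj : 1 ≤ j) (hji : j ≤ i) (hi : i ≤ n) :
    (ofPartitions n L).entry i j = L i (i - j) + 1 :=
  IntArray.entry_of_mem _ (mem_triangleIndex.2 ⟨hj, hji, hi⟩)

theorem rowPartition_ofPartitions {L : ℕ → ℕ → ℤ} (hL : ∀ i r, i ≤ r → L i r = 0) (i r : ℕ) :
    rowPartition (ofPartitions n L) i r = L (min i n) r := by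
  rw [rowPartition]
  split_ifs with h
  · rw [entry_ofPartitions L (by omega) (by omega) (min_le_right i n), add_sub_cancel_right,
      Nat.sub_sub_self h.le]
  · exact (hL _ _ (not_lt.1 h)).symm

theorem IsGelfandTsetlin.rowPartition_nonneg {X : IntArray (triangleIndex n)}
    (hX : IsGelfandTsetlin X) (i r : ℕ) : 0 ≤ rowPartition X i r := by
  rw [rowPartition]
  split_ifs with h
  · rw [X.entry_of_mem (mem_triangleIndex.2 (by omega))]
    exact Int.le_sub_one_of_lt (hX.pos _)
  · exact le_rfl

theorem IsGelfandTsetlin.interlaces_rowPartition {X : IntArray (triangleIndex n)}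
    (hX : IsGelfandTsetlin X) {i : ℕ} (hi : i < n) :
    Interlaces (rowPartition X (i + 1)) (rowPartition X i) := fun r => by
  rcases lt_or_ge r i with hr | hr
  · obtain ⟨j, rfl⟩ := Nat.exists_eq_add_of_le hr.le
    have h := hX.interlace (r + j) j (by omega) (by omega) hi
    rw [rowPartition_eq_entry_sub_one X rfl (by omega) hi.le,
      rowPartition_eq_entry_sub_one X (Nat.add_right_comm r j 1) (by omega) hi,
      rowPartition_eq_entry_sub_one X (Nat.add_assoc r j 1) (by omega) hi]
    exact ⟨sub_le_sub_right h.1 1, sub_le_sub_right h.2 1⟩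
  · rw [rowPartition_eq_zero X (i := i) (by omega), rowPartition_eq_zero X (by omega)]
    exact ⟨le_rfl, hX.rowPartition_nonneg _ _⟩

theorem IsGelfandTsetlin.isPattern {X : IntArray (triangleIndex n)} (hX : IsGelfandTsetlin X) :
    IsPattern (rowPartition X) where
  zero r := rowPartition_eq_zero X (by omega)
  interlaces i := by
    rcases lt_or_ge i n with hi | hi
    · exact hX.interlaces_rowPartition hi
    have top {i : ℕ} (hi : n ≤ i) : rowPartition X i = rowPartition X n := funext fun r => by
      rw [← rowPartition_min, min_eq_right hi]
    rw [top hi, top (Nat.le_succ_of_le hi)]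
    refine fun r => ⟨?_, le_rfl⟩
    cases n with
    | zero => rw [rowPartition_eq_zero X (by omega), rowPartition_eq_zero X (by omega)]
    | succ m =>
      have h := hX.interlaces_rowPartition m.lt_succ_self r
      exact h.1.trans h.2

theorem ofPartitions_rowPartition (X : IntArray (triangleIndex n)) :
    ofPartitions n (rowPartition X) = X := by
  ext ⟨⟨i, j⟩, hp⟩
  obtain ⟨hj, hji, hi⟩ := mem_triangleIndex.1 hp
  rw [← X.entry_of_mem hp, entry_eq_rowPartition_add_one X hj hji hi, ofPartitions]

theorem IsPattern.isGelfandTsetlin_ofPartitions {L : ℕ → ℕ → ℤ} (hL : IsPattern L) :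
    IsGelfandTsetlin (ofPartitions n L) where
  pos p := Int.lt_add_one_of_le (hL.nonneg p.1.1 (p.1.1 - p.1.2))
  interlace i j hj hji hi := by
    have h := hL.interlaces i (i - j)
    rw [entry_ofPartitions L hj hji (Nat.le_of_succ_le hi),
      entry_ofPartitions L hj (by omega) hi,
      entry_ofPartitions L (by omega) (by omega) hi, Nat.add_sub_add_right,
      Nat.succ_sub hji]
    exact ⟨add_le_add_left h.1 1, add_le_add_left h.2 1⟩

theorem entry_rowReflection_of_ne (X : IntArray (triangleIndex n)) {k i : ℕ} (h : i ≠ k)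
    (j : ℕ) : (rowReflection k X).entry i j = X.entry i j := by
  simp only [IntArray.entry, rowReflection, if_neg h]

theorem entry_rowReflection (X : IntArray (triangleIndex n)) {k j : ℕ} (hj : 1 ≤ j) (hjk : j ≤ k)
    (hk : k ≤ n) : (rowReflection k X).entry k j =
      (if j = 1 then X.entry (k + 1) j else max (X.entry (k + 1) j) (X.entry (k - 1) (j - 1)))
      + (if j = k then X.entry (k + 1) (j + 1)
          else min (X.entry (k + 1) (j + 1)) (X.entry (k - 1) j))
      - X.entry k j := by
  have hm : (k, j) ∈ triangleIndex n := mem_triangleIndex.2 ⟨hj, hjk, hk⟩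
  rw [IntArray.entry_of_mem _ hm, IntArray.entry_of_mem X hm]
  exact if_pos rfl

theorem IsGelfandTsetlin.max_rowPartition {X : IntArray (triangleIndex n)}
    (hX : IsGelfandTsetlin X) {k r j : ℕ} (h : k + 1 = r + j) (hj : 1 ≤ j) (hk : k + 2 ≤ n) :
    max (rowPartition X (k + 2) (r + 1)) (rowPartition X k r) =
      (if j = 1 then X.entry (k + 2) j else max (X.entry (k + 2) j) (X.entry k (j - 1))) - 1 := by
  rw [rowPartition_eq_entry_sub_one X (i := k + 2) (j := j) (by omega) hj hk]
  split_ifs with hj'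
  · rw [rowPartition_eq_zero X (i := k) (by omega), max_eq_left]
    rw [← rowPartition_eq_entry_sub_one X (r := r + 1) (by omega) hj hk]
    exact hX.rowPartition_nonneg _ _
  · rw [rowPartition_eq_entry_sub_one X (i := k) (j := j - 1) (by omega) (by omega) (by omega),
      max_sub_sub_right]

theorem IsGelfandTsetlin.rowPartition_rowReflection_self {X : IntArray (triangleIndex n)}
    (hX : IsGelfandTsetlin X) {k : ℕ} (hk : k + 2 ≤ n) :
    rowPartition (rowReflection (k + 1) X) (k + 1) =
      reflectedRow (rowPartition X (k + 2)) (rowPartition X (k + 1)) (rowPartition X k) := by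
  funext r
  rcases lt_or_ge k r with hr | hr
  · obtain ⟨r, rfl⟩ := Nat.exists_eq_add_of_lt hr
    rw [reflectedRow, min_eq_right ((rowPartition_eq_zero X (by omega)).trans_le
        (hX.rowPartition_nonneg _ _)),
      rowPartition_eq_zero _ (by omega), rowPartition_eq_zero X (by omega),
      rowPartition_eq_zero X (i := k) (by omega), rowPartition_eq_zero X (i := k) (by omega),
      rowPartition_eq_zero X (by omega)]
    rfl
  · obtain ⟨j, rfl⟩ := Nat.exists_eq_add_of_le hr
    have lower := hX.max_rowPartition (k := r + j) (add_assoc r j 1) (by omega) hk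
    rw [rowPartition_eq_entry_sub_one _ (add_assoc r j 1) (by omega) (by omega),
      entry_rowReflection X (by omega) (by omega) (by omega)]
    cases r with
    | zero =>
      rw [reflectedRow, lower,
        rowPartition_eq_entry_sub_one X (i := 0 + j + 2) (j := j + 2) (by omega) (by omega) hk,
        rowPartition_eq_entry_sub_one X (i := 0 + j + 1) (j := j + 1) (by omega) (by omega)
          (by omega), if_pos (c := j + 1 = 0 + j + 1) (by omega)]
      simp only [Nat.add_sub_cancel]
      ring
    | succ r =>
      rw [reflectedRow, lower,
        rowPartition_eq_entry_sub_one X (i := r + 1 + j + 2) (j := j + 2) (by omega) (by omega) hk,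
        rowPartition_eq_entry_sub_one X (i := r + 1 + j) (j := j + 1) (by omega) (by omega)
          (by omega),
        rowPartition_eq_entry_sub_one X (i := r + 1 + j + 1) (j := j + 1) (by omega) (by omega)
          (by omega), if_neg (c := j + 1 = r + 1 + j + 1) (by omega), min_sub_sub_right]
      simp only [Nat.add_sub_cancel]
      ring

theorem IsGelfandTsetlin.rowPartition_rowReflection {X : IntArray (triangleIndex n)}
    (hX : IsGelfandTsetlin X) {k : ℕ} (hk : k + 2 ≤ n) :
    rowPartition (rowReflection (k + 1) X) = Function.update (rowPartition X) (k + 1)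
      (reflectedRow (rowPartition X (k + 2)) (rowPartition X (k + 1)) (rowPartition X k)) := by
  refine Function.eq_update_iff.2 ⟨hX.rowPartition_rowReflection_self hk, fun i hi => ?_⟩
  funext r
  simp only [rowPartition, entry_rowReflection_of_ne X (show min i n ≠ k + 1 by omega)]

theorem IsGelfandTsetlin.map_rowReflection {X : IntArray (triangleIndex n)}
    (hX : IsGelfandTsetlin X) {k : ℕ} (hk : k + 2 ≤ n) :
    IsGelfandTsetlin (rowReflection (k + 1) X) := by
  rw [← ofPartitions_rowPartition (rowReflection (k + 1) X), hX.rowPartition_rowReflection hk]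
  exact (hX.isPattern.update_reflectedRow k).isGelfandTsetlin_ofPartitions

theorem IsGelfandTsetlin.map_rowSweep {X : IntArray (triangleIndex n)}
    (hX : IsGelfandTsetlin X) : ∀ m, m + 1 ≤ n → IsGelfandTsetlin (rowSweep m X)
  | 0, _ => hX
  | m + 1, hm => (hX.map_rowSweep m (by omega)).map_rowReflection hm

theorem IsGelfandTsetlin.map_sweepProduct : ∀ m {X : IntArray (triangleIndex n)},
    IsGelfandTsetlin X → m + 1 ≤ n → IsGelfandTsetlin (sweepProduct m X)
  | 0, _, hX, _ => hX
  | m + 1, _, hX, hm => map_sweepProduct m (hX.map_rowSweep (m + 1) hm) (by omega)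

theorem IsGelfandTsetlin.rowPartition_rowSweep {X : IntArray (triangleIndex n)}
    (hX : IsGelfandTsetlin X) : ∀ m, m + 1 ≤ n → ∀ i, rowPartition (rowSweep m X) i =
      if i ≤ m then promotion (rowPartition X) i else rowPartition X i
  | 0, _, i => by
    split_ifs with hi
    · obtain rfl := Nat.le_zero.1 hi
      exact funext hX.isPattern.zero
    · rfl
  | m + 1, hm, i => by
    have ih := hX.rowPartition_rowSweep m (by omega)
    rw [rowSweep, Function.comp_apply,
      (hX.map_rowSweep m (by omega)).rowPartition_rowReflection hm]
    rcases eq_or_ne i (m + 1) with rfl | hi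
    · rw [Function.update_self, ih, ih, ih, if_neg (by omega), if_neg (by omega), if_pos le_rfl,
        if_pos le_rfl, promotion]
    · rw [Function.update_of_ne hi, ih]
      exact if_congr (by omega) rfl rfl

theorem IsGelfandTsetlin.rowPartition_sweepProduct_of_lt : ∀ m {X : IntArray (triangleIndex n)},
    IsGelfandTsetlin X → m + 1 ≤ n → ∀ i, m < i →
      rowPartition (sweepProduct m X) i = rowPartition X i
  | 0, _, _, _, _, _ => rfl
  | m + 1, X, hX, hm, i, hi => by
    rw [sweepProduct, Function.comp_apply, rowPartition_sweepProduct_of_lt m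
      (hX.map_rowSweep (m + 1) hm) (by omega) i (by omega), hX.rowPartition_rowSweep _ hm,
      if_neg (by omega)]

theorem IsGelfandTsetlin.rowPartition_sweepProduct (t : ℕ) : ∀ d {X : IntArray (triangleIndex n)},
    IsGelfandTsetlin X → t + d + 1 ≤ n → rowPartition (sweepProduct (t + d) X) (t + 1) 0 =
      lastPassage (letterCount (rowPartition X) d) n 0 (t + 1)
  | 0, X, hX, ht => by
    rw [Nat.add_zero, hX.rowPartition_sweepProduct_of_lt t ht (t + 1) t.lt_succ_self,
      hX.isPattern.lastPassage_letterCount_zero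
        (fun _ _ h => rowPartition_eq_zero X (min_le_of_right_le h)) n 0 (by omega)]
  | d + 1, X, hX, ht => by
    have sweep := hX.rowPartition_rowSweep (t + d + 1) ht
    rw [← Nat.add_assoc, sweepProduct, Function.comp_apply,
      rowPartition_sweepProduct t d (hX.map_rowSweep (t + d + 1) ht) (by omega),
      ← hX.isPattern.lastPassage_promotion
        (fun _ _ h => rowPartition_eq_zero X (min_le_of_right_le h))]
    refine lastPassage_congr (fun r b hb => ?_) n 0
    rw [letterCount, letterCount, sweep, sweep, if_pos (by omega), if_pos (by omega)]

theorem IsGelfandTsetlin.map_schutzenberger {X : IntArray (triangleIndex n)}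
    (hX : IsGelfandTsetlin X) : IsGelfandTsetlin (schutzenberger X) := by
  cases n with
  | zero => exact hX
  | succ m => exact hX.map_sweepProduct m le_rfl

theorem IsGelfandTsetlin.entry_schutzenberger {X : IntArray (triangleIndex n)}
    (hX : IsGelfandTsetlin X) {j : ℕ} (hj : 1 ≤ j) (hjn : j ≤ n) :
    (schutzenberger X).entry j j =
      lastPassage (letterCount (rowPartition X) (n - j)) n 0 j + 1 := by
  obtain ⟨t, rfl⟩ := Nat.exists_eq_add_of_le' hj
  have h := hX.rowPartition_sweepProduct t (n - (t + 1)) (by omega)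
  rw [show t + (n - (t + 1)) = n - 1 by omega] at h
  rw [entry_eq_rowPartition_add_one _ hj le_rfl hjn, Nat.sub_self, schutzenberger, h]

theorem isGOGAm_iff {X : IntArray (triangleIndex n)} :
    IsGOGAm X ↔ IsGelfandTsetlin X ∧ ∀ j : ℕ, 1 ≤ j → j ≤ n →
      lastPassage (letterCount (rowPartition X) (n - j)) n 0 j + 1 ≤ j where
  mp hX := ⟨hX.gelfandTsetlin, fun j hj hjn =>
    (hX.gelfandTsetlin.entry_schutzenberger hj hjn).ge.trans (hX.magog.diagonal j hj hjn)⟩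
  mpr h := ⟨h.1, h.1.map_schutzenberger, fun j hj hjn =>
    (h.1.entry_schutzenberger hj hjn).trans_le (h.2 j hj hjn)⟩

theorem IsGOGAm.of_rowPartition_sub_le {T X : IntArray (triangleIndex n)} (hT : IsGOGAm T)
    (hX : IsGelfandTsetlin X) (h : ∀ i < n, ∀ r, rowPartition X (i + 1) r - rowPartition X i r ≤
      rowPartition T (i + 1) r - rowPartition T i r) : IsGOGAm X := by
  refine isGOGAm_iff.2 ⟨hX, fun j hj hjn => le_trans ?_ ((isGOGAm_iff.1 hT).2 j hj hjn)⟩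
  gcongr
  exact lastPassage_mono (fun r b hb => h (b + (n - j)) (by omega) r) n 0 j le_rfl

theorem IsGOGAm.isGOGAm_ofPartitions {T : IntArray (triangleIndex n)} (hT : IsGOGAm T)
    {L : ℕ → ℕ → ℤ} (hL : IsPattern L) (h : ∀ i < n, ∀ r, L (i + 1) r - L i r ≤
      rowPartition T (i + 1) r - rowPartition T i r) :
    IsGOGAm (ofPartitions n L) := by
  refine hT.of_rowPartition_sub_le hL.isGelfandTsetlin_ofPartitions fun i hi r => ?_
  rw [rowPartition_ofPartitions hL.eq_zero, rowPartition_ofPartitions hL.eq_zero,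
    min_eq_left hi.le, min_eq_left (Nat.succ_le_of_lt hi)]
  exact h i hi r

end Triangle

section Completion

variable {n k : ℕ} {T T' : IntArray (triangleIndex n)}

theorem ofPartitions_le {L : ℕ → ℕ → ℤ} (h : ∀ i ≤ n, ∀ r, L i r ≤ rowPartition T i r) :
    ofPartitions n L ≤ T := by
  intro p
  rw [← ofPartitions_rowPartition T]
  exact add_le_add_left (h _ (mem_triangleIndex.1 p.2).2.2 _) 1

/-- The triangle whose tableau consists of the first `k` rows of the tableau of `T`; this is the
right completion. -/
def rightFill (k : ℕ) (T : IntArray (triangleIndex n)) : IntArray (triangleIndex n) :=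
  ofPartitions n fun i r => if r < k then rowPartition T i r else 0

/-- The triangle whose tableau consists of the letters at most `r + k` in row `r` of the tableau
of `T`, for all `r` counted from `0`; this is the left completion. -/
def leftFill (k : ℕ) (T : IntArray (triangleIndex n)) : IntArray (triangleIndex n) :=
  ofPartitions n fun i r => rowPartition T (min i (r + k)) r

theorem IsGOGAm.map_rightFill (hT : IsGOGAm T) : IsGOGAm (rightFill k T) := by
  have pattern := hT.gelfandTsetlin.isPattern
  refine hT.isGOGAm_ofPartitions (pattern.truncate k) fun i _ r => ?_
  split_ifs
  · exact le_rfl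
  · rw [sub_self]
    exact sub_nonneg.2 (pattern.monotone r i.le_succ)

theorem IsGOGAm.map_leftFill (hT : IsGOGAm T) : IsGOGAm (leftFill k T) := by
  have pattern := hT.gelfandTsetlin.isPattern
  refine hT.isGOGAm_ofPartitions (pattern.stabilize k) fun i _ r => ?_
  rcases lt_or_ge i (r + k) with hi | hi
  · rw [min_eq_left hi.le, min_eq_left (Nat.succ_le_of_lt hi)]
  · rw [min_eq_right hi, min_eq_right (Nat.le_succ_of_le hi), sub_self]
    exact sub_nonneg.2 (pattern.monotone r i.le_succ)

section Right

variable {X : IntArray (rightIndex n k)}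

theorem ExtendsRight.entry_eq (h : ExtendsRight T X) {i j : ℕ} (hp : (i, j) ∈ rightIndex n k) :
    T.entry i j = X.entry i j := by
  rw [T.entry_of_mem (rightIndex_subset n k hp), X.entry_of_mem hp, h _ hp]

theorem ExtendsRight.rowPartition_eq (h : ExtendsRight T X) (h' : ExtendsRight T' X) (i : ℕ)
    {r : ℕ} (hr : r < k) : rowPartition T i r = rowPartition T' i r := by
  rw [rowPartition, rowPartition]
  split_ifs
  · have hp : (min i n, min i n - r) ∈ rightIndex n k :=
      Finset.mem_filter.2 ⟨mem_triangleIndex.2 (by omega), by omega⟩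
    rw [h.entry_eq hp, h'.entry_eq hp]
  · rfl

theorem ExtendsRight.map_rightFill (h : ExtendsRight T X) : ExtendsRight (rightFill k T) X :=
  fun p hp => by
    have hpk : p.1 - p.2 < k := by
      obtain ⟨hp, h⟩ := Finset.mem_filter.1 hp
      have := mem_triangleIndex.1 hp
      omega
    rw [← h p hp]
    nth_rw 2 [← ofPartitions_rowPartition T]
    exact congrArg (· + 1) (if_pos hpk)

theorem IsGOGAm.isRightCompletion_rightFill (hT : IsGOGAm T) (hTX : ExtendsRight T X) :
    IsRightCompletion X (rightFill k T) := by
  refine ⟨⟨hT.map_rightFill, hTX.map_rightFill⟩, fun T' ⟨hT', hT'X⟩ => ?_⟩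
  refine ofPartitions_le fun i _ r => ?_
  split_ifs with hr
  · exact (hTX.rowPartition_eq hT'X i hr).le
  · exact hT'.gelfandTsetlin.rowPartition_nonneg i r

theorem entry_rightFill_of_add_le (T : IntArray (triangleIndex n)) {i j : ℕ} (hj : 1 ≤ j)
    (hji : j + k ≤ i) (hi : i ≤ n) : (rightFill k T).entry i j = 1 := by
  rw [rightFill, entry_ofPartitions _ hj (by omega) hi, if_neg (by omega), zero_add]

end Right

section Left

variable {X : IntArray (leftIndex n k)}

theorem ExtendsLeft.entry_eq (h : ExtendsLeft T X) {i j : ℕ} (hp : (i, j) ∈ leftIndex n k) :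
    T.entry i j = X.entry i j := by
  rw [T.entry_of_mem (leftIndex_subset n k hp), X.entry_of_mem hp, h _ hp]

theorem ExtendsLeft.rowPartition_eq (h : ExtendsLeft T X) (h' : ExtendsLeft T' X) {i r : ℕ}
    (hi : i ≤ r + k) : rowPartition T i r = rowPartition T' i r := by
  rw [rowPartition, rowPartition]
  split_ifs
  · have hp : (min i n, min i n - r) ∈ leftIndex n k :=
      Finset.mem_filter.2 ⟨mem_triangleIndex.2 (by omega), by dsimp only; omega⟩
    rw [h.entry_eq hp, h'.entry_eq hp]
  · rfl

theorem ExtendsLeft.map_leftFill (h : ExtendsLeft T X) : ExtendsLeft (leftFill k T) X :=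
  fun p hp => by
    have hpk : p.1 ≤ p.1 - p.2 + k := by
      have := (Finset.mem_filter.1 hp).2
      omega
    rw [← h p hp]
    nth_rw 2 [← ofPartitions_rowPartition T]
    exact congrArg (rowPartition T · (p.1 - p.2) + 1) (min_eq_left hpk)

theorem IsGOGAm.isLeftCompletion_leftFill (hT : IsGOGAm T) (hTX : ExtendsLeft T X) :
    IsLeftCompletion X (leftFill k T) := by
  refine ⟨⟨hT.map_leftFill, hTX.map_leftFill⟩, fun T' ⟨hT', hT'X⟩ => ?_⟩
  refine ofPartitions_le fun i _ r => ?_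
  rw [hTX.rowPartition_eq hT'X (min_le_right i (r + k))]
  exact hT'.gelfandTsetlin.isPattern.monotone r (min_le_left i (r + k))

theorem ExtendsLeft.entry_leftFill (h : ExtendsLeft T X) {i j : ℕ} (hk : 1 ≤ k) (hkj : k ≤ j)
    (hji : j ≤ i) (hi : i ≤ n) : (leftFill k T).entry i j = X.entry (i - j + k) k := by
  have hp : (i - j + k, k) ∈ leftIndex n k :=
    Finset.mem_filter.2 ⟨mem_triangleIndex.2 (by omega), le_rfl⟩
  rw [leftFill, entry_ofPartitions _ (by omega) hji hi, min_eq_right (by omega), ← h.entry_eq hp,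
    rowPartition_eq_entry_sub_one T rfl hk (by omega), sub_add_cancel]

end Left

end Completion

theorem mainTheorem5 (n k : ℕ) (hk : 1 ≤ k) (hkn : k ≤ n) :
    (∀ X : IntArray (rightIndex n k), IsRightGOGAmTrapezoid X →
      ∃ C : IntArray (triangleIndex n), IsRightCompletion X C ∧
        ∀ i j : ℕ, 1 ≤ j → j + k ≤ i → i ≤ n → C.entry i j = 1) ∧
    (∀ X : IntArray (leftIndex n k), IsLeftGOGAmTrapezoid X →
      ∃ C : IntArray (triangleIndex n), IsLeftCompletion X C ∧
        ∀ i j : ℕ, k ≤ j → j ≤ i → i ≤ n → C.entry i j = X.entry (i - j + k) k) :=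
  ⟨fun _ ⟨T, hT, hTX⟩ => ⟨rightFill k T, hT.isRightCompletion_rightFill hTX,
      fun _ _ => entry_rightFill_of_add_le T⟩,
    fun _ ⟨T, hT, hTX⟩ => ⟨leftFill k T, hT.isLeftCompletion_leftFill hTX,
      fun _ _ => hTX.entry_leftFill hk⟩⟩
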